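/- Let $L/K$ be a finite separable field extension, let $E$ be the normal closure of $L/K$ (so $K\subseteq L\subseteq E$), and suppose that $L/K$ admits a Hopf-Galois structure, that is: there are a cocommutative $K$-Hopf algebra $H$ with comultiplication $h\mapsto\sum_{(h)}h_{(1)}\otimes h_{(2)}$ and counit $\varepsilon$, and an action of the algebra $H$ on $L$ by $K$-linear endomorphisms, such that $h\cdot(xy)=\sum_{(h)}(h_{(1)}\cdot x)(h_{(2)}\cdot y)$ and $h\cdot k=\varepsilon(h)k$ for all $h\in H$, $x,y\in L$, $k\in K$, and such that the $K$-linear map $L\otimes_K H\to\mathrm{End}_K(L)$, $x\otimes h\mapsto\bigl(y\mapsto x(h\cdot y)\bigr)$, is bijective. Let $G$ be a group acting faithfully and transitively on a finite set $X$ whose cardinality $n=|X|$ is squarefree, and suppose that $L/K$ realises this permutation group, that is, there are a point $x\in X$ and an isomorphism $\theta\colon G\to\mathrm{Gal}(E/K)$ which carries the stabiliser $G_x$ onto $\mathrm{Gal}(E/L)$. Then $G$ has derived length at most $4$, i.e. the fourth term $G^{(4)}$ of its derived series ($G^{(0)}=G$, $G^{(i+1)}=[G^{(i)},G^{(i)}]$)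 is trivial. In particular, $G$ is soluble. -/

import Mathlib

open scoped TensorProduct

/-- The `K`-linear map `L ⊗ H → End_K(L)` with `x ⊗ h ↦ (y ↦ x * (h · y))`, where `h · y = ρ h y`. -/
noncomputable def hopfGaloisMap {K L H : Type*} [Field K] [Field L] [Algebra K L]
    [Ring H] [Algebra K H] (ρ : H →ₐ[K] Module.End K L) :
    L ⊗[K] H →ₗ[K] Module.End K L :=
  TensorProduct.lift
    ((LinearMap.mul K (Module.End K L)).compl₁₂ (Algebra.lmul K L).toLinearMap ρ.toLinearMap)

theorem hopfGaloisMap_tmul {K L H : Type*} [Field K] [Field L] [Algebra K L]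
    [Ring H] [Algebra K H] (ρ : H →ₐ[K] Module.End K L) (x : L) (h : H) (y : L) :
    hopfGaloisMap ρ (x ⊗ₜ[K] h) y = x * ρ h y := rfl

/-- A Hopf-Galois structure on `L/K` with underlying cocommutative `K`-Hopf algebra `H`: an action
of `H` on `L` by `K`-linear endomorphisms which makes `L` an `H`-module algebra and for which
`L ⊗ H → End_K(L)` is bijective. -/
structure HopfGaloisStructure (K L H : Type*) [Field K] [Field L] [Algebra K L]
    [Ring H] [HopfAlgebra K H] [Coalgebra.IsCocomm K H] where
  /-- The action `h · y = act h y` of `H` on `L`. -/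
  act : H →ₐ[K] Module.End K L
  /-- `h · (x * y) = ∑ (h₁ · x) * (h₂ · y)`, where `comul h = ∑ h₁ ⊗ h₂`. -/
  act_mul : ∀ (h : H) (x y : L),
    act h (x * y) = LinearMap.mul' K L
      (TensorProduct.map (act.toLinearMap.flip x) (act.toLinearMap.flip y)
        (Coalgebra.comul (R := K) h))
  /-- `h · k = ε(h) k` for `k` in the ground field. -/
  act_algebraMap : ∀ (h : H) (k : K),
    act h (algebraMap K L k) = algebraMap K L (Coalgebra.counit (R := K) h * k)
  bijective : Function.Bijective (hopfGaloisMap act)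

/-- The extension `L/K`, with normal closure `E/K`, realises the (transitive) permutation group `G`
on `X`: there is an isomorphism `G ≃ Gal(E/K)` carrying a point stabiliser onto `Gal(E/L)`. -/
def RealisesPermGroup (K L E G X : Type*) [Field K] [Field L] [Field E]
    [Algebra K L] [Algebra K E] [Algebra L E] [IsScalarTower K L E]
    [Group G] [MulAction G X] : Prop :=
  ∃ (x : X) (θ : G ≃* (E ≃ₐ[K] E)),
    (MulAction.stabilizer G x).map θ.toMonoidHom =
      (IsScalarTower.toAlgHom K L E).fieldRange.fixingSubgroup

/-!
The group-like elements of `E ⊗ H` permute the `K`-embeddings of `L` into `E`, simply transitively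
because the Galois map of the Hopf-Galois structure is bijective, and `Gal(E/K)` normalises the
resulting group `N` of permutations (Greither–Pareigis). As `N` is regular, the kernel of the
conjugation action of its normaliser on `N`, which is the centraliser of `N`, acts freely on the
embeddings. Hence `N` and this kernel have squarefree order. A group of squarefree order has cyclic
commutator subgroup and cyclic abelianization. It is therefore metabelian, and so is its
automorphism group, because automorphisms trivial on both the commutator subgroup and the
abelianization commute with each other. Thus `Gal(E/K)` has derived length at most `2 + 2`.
-/

section DerivedLength

variable {G Q : Type*} [Group G] [Group Q]

theorem derivedSeries_add_le_map_derivedSeries {m : ℕ} {N : Subgroup G}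
    (hN : derivedSeries G m ≤ N) (n : ℕ) :
    derivedSeries G (m + n) ≤ (derivedSeries N n).map N.subtype := by
  induction n with
  | zero => rwa [add_zero, derivedSeries_zero, ← MonoidHom.range_eq_map, Subgroup.range_subtype]
  | succ n ih =>
    rw [← add_assoc, derivedSeries_succ, derivedSeries_succ, Subgroup.map_commutator]
    exact Subgroup.commutator_mono ih ih

theorem derivedSeries_add_eq_bot (f : G →* Q) {m n : ℕ} (hQ : derivedSeries Q m = ⊥)
    (hker : derivedSeries f.ker n = ⊥) : derivedSeries G (m + n) = ⊥ := by
  have hle : derivedSeries G m ≤ f.ker := by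
    have := map_derivedSeries_le_derivedSeries f m
    rwa [hQ, le_bot_iff, Subgroup.map_eq_bot_iff] at this
  simpa only [hker, Subgroup.map_bot, le_bot_iff] using derivedSeries_add_le_map_derivedSeries hle n

theorem derivedSeries_eq_bot_of_injective {f : G →* Q} (hf : Function.Injective f) {n : ℕ}
    (hQ : derivedSeries Q n = ⊥) : derivedSeries G n = ⊥ := by
  have := map_derivedSeries_le_derivedSeries f n
  rwa [hQ, le_bot_iff, Subgroup.map_eq_bot_iff_of_injective _ hf] at this

variable (G) in
theorem derivedSeries_one_eq_bot [IsMulCommutative G] : derivedSeries G 1 = ⊥ :=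
  (derivedSeries_one G).trans (commutator_eq_bot G)

end DerivedLength

section Metacyclic

variable {N : Type*} [Group N]

theorem derivedSeries_two_eq_bot [IsMulCommutative (commutator N)] : derivedSeries N 2 = ⊥ := by
  have hker : derivedSeries (Abelianization.of (G := N)).ker 1 = ⊥ := by
    rw [Abelianization.ker_of]
    exact derivedSeries_one_eq_bot _
  exact derivedSeries_add_eq_bot Abelianization.of (derivedSeries_one_eq_bot _) hker

variable (N) in
theorem isMulCommutative_mulAut_of_isCyclic [IsCyclic N] : IsMulCommutative (MulAut N) :=
  .of_comm fun α β => (IsCyclic.mulAutMulEquiv N).injective <| by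
    rw [map_mul, map_mul, mul_comm]

theorem commute_of_stabilizes {A : Subgroup N} [IsMulCommutative A] {α β : MulAut N}
    (hαA : ∀ a ∈ A, α a = a) (hβA : ∀ a ∈ A, β a = a) (hα : ∀ x, x⁻¹ * α x ∈ A)
    (hβ : ∀ x, x⁻¹ * β x ∈ A) : Commute α β := by
  ext x
  have hcomm : x⁻¹ * α x * (x⁻¹ * β x) = x⁻¹ * β x * (x⁻¹ * α x) :=
    setLike_mul_comm (hα x) (hβ x)
  calc α (β x) = α (x * (x⁻¹ * β x)) := by rw [mul_inv_cancel_left]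
    _ = x * (x⁻¹ * α x * (x⁻¹ * β x)) := by
      rw [map_mul, hαA _ (hβ x), mul_assoc x⁻¹, mul_inv_cancel_left]
    _ = β (x * (x⁻¹ * α x)) := by
      rw [hcomm, map_mul, hβA _ (hα x), mul_assoc x⁻¹, mul_inv_cancel_left]
    _ = β (α x) := by rw [mul_inv_cancel_left]

variable (N) in
/-- The action of the automorphisms of `N` on the abelianization of `N`. -/
def autAbelianization : MulAut N →* MulAut (Abelianization N) where
  toFun α := α.abelianizationCongr
  map_one' := by ext x; induction x using QuotientGroup.induction_on; rfl
  map_mul' α β := by ext x; induction x using QuotientGroup.induction_on; rfl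

theorem derivedSeries_mulAut_two_eq_bot [IsCyclic (commutator N)] [IsCyclic (Abelianization N)] :
    derivedSeries (MulAut N) 2 = ⊥ := by
  let ρ := (MulAut.characteristic (commutator N)).prod (autAbelianization N)
  have hfix (α : MulAut N) (hα : α ∈ ρ.ker) (a) (ha : a ∈ commutator N) : α a = a :=
    congrArg Subtype.val (DFunLike.congr_fun (congrArg Prod.fst hα) (⟨a, ha⟩ : commutator N))
  have hquot (α : MulAut N) (hα : α ∈ ρ.ker) (x) : x⁻¹ * α x ∈ commutator N := by
    have hx : Abelianization.of (α x) = Abelianization.of x :=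
      DFunLike.congr_fun (congrArg Prod.snd hα) (Abelianization.of x)
    rw [← Abelianization.ker_of, MonoidHom.mem_ker, map_mul, map_inv, hx, inv_mul_cancel]
  have : IsMulCommutative ρ.ker := .of_comm fun α β => Subtype.ext <|
    commute_of_stabilizes (hfix α α.2) (hfix β β.2) (hquot α α.2) (hquot β β.2)
  have := isMulCommutative_mulAut_of_isCyclic (commutator N)
  have := isMulCommutative_mulAut_of_isCyclic (Abelianization N)
  have : IsMulCommutative (MulAut (commutator N) × MulAut (Abelianization N)) :=
    .of_comm fun _ _ => Prod.ext (mul_comm' _ _) (mul_comm' _ _)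
  exact derivedSeries_add_eq_bot ρ (derivedSeries_one_eq_bot _) (derivedSeries_one_eq_bot _)

theorem derivedSeries_two_eq_bot_of_squarefree (hN : Squarefree (Nat.card N)) :
    derivedSeries N 2 = ⊥ := by
  have : Finite N := Nat.finite_of_card_ne_zero hN.ne_zero
  have := IsZGroup.of_squarefree hN
  have := IsZGroup.isCyclic_commutator (G := N)
  exact derivedSeries_two_eq_bot

theorem derivedSeries_mulAut_two_eq_bot_of_squarefree (hN : Squarefree (Nat.card N)) :
    derivedSeries (MulAut N) 2 = ⊥ := by
  have : Finite N := Nat.finite_of_card_ne_zero hN.ne_zero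
  have := IsZGroup.of_squarefree hN
  have := IsZGroup.isCyclic_commutator (G := N)
  exact derivedSeries_mulAut_two_eq_bot

end Metacyclic

section RegularNormalizer

variable {G Y : Type*} [Group G] [MulAction G Y]

variable (G Y) in
theorem card_dvd_card_of_isCancelSMul [IsCancelSMul G Y] : Nat.card G ∣ Nat.card Y := by
  have hfree (y : Y) : MulAction.stabilizer G y = ⊥ :=
    (Subgroup.eq_bot_iff_forall _).mpr fun _ hg => IsCancelSMul.eq_one_of_smul hg
  rw [Nat.card_congr (MulAction.selfEquivOrbitsQuotientProd hfree), Nat.card_prod]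
  exact dvd_mul_left _ _

theorem isCancelSMul_centralizer [FaithfulSMul G Y] (N : Subgroup G)
    [MulAction.IsPretransitive N Y] : IsCancelSMul (Subgroup.centralizer (N : Set G)) Y := by
  refine isCancelSMul_iff_eq_one_of_smul_eq.mpr fun c y hc => ?_
  refine Subtype.ext (eq_of_smul_eq_smul (α := Y) fun z => ?_)
  obtain ⟨n, rfl⟩ := MulAction.exists_smul_eq N y z
  calc (c : G) • (n : G) • y = (n : G) • (c : G) • y := by
        rw [smul_smul, smul_smul, Subgroup.mem_centralizer_iff.mp c.2 n n.2]
    _ = (1 : G) • (n : G) • y := by rw [one_smul]; exact congrArg _ hc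

theorem derivedSeries_normalizer_eq_bot [FaithfulSMul G Y] (hY : Squarefree (Nat.card Y))
    (N : Subgroup G) [MulAction.IsPretransitive N Y] [IsCancelSMul N Y] :
    derivedSeries (Subgroup.normalizer (N : Set G)) 4 = ⊥ := by
  have := isCancelSMul_centralizer (Y := Y) N
  have hN : Squarefree (Nat.card N) :=
    hY.squarefree_of_dvd (card_dvd_card_of_isCancelSMul N Y)
  have hC : Squarefree (Nat.card (Subgroup.centralizer (N : Set G))) :=
    hY.squarefree_of_dvd (card_dvd_card_of_isCancelSMul _ Y)
  have hker : derivedSeries N.normalizerMonoidHom.ker 2 = ⊥ := by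
    rw [N.normalizerMonoidHom_ker]
    let e := Subgroup.subgroupOfEquivOfLe (Subgroup.centralizer_le_normalizer (N : Set G))
    exact derivedSeries_eq_bot_of_injective (f := e.toMonoidHom) e.injective
      (derivedSeries_two_eq_bot_of_squarefree hC)
  exact derivedSeries_add_eq_bot N.normalizerMonoidHom
    (derivedSeries_mulAut_two_eq_bot_of_squarefree hN) hker

end RegularNormalizer

section Embeddings

variable {K L E : Type*} [Field K] [Field L] [Field E] [Algebra K L] [Algebra K E]

/-- The Galois group of `E/K` acts on the embeddings of `L` into `E` by composition. -/
instance : MulAction (E ≃ₐ[K] E) (L →ₐ[K] E) where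
  smul γ σ := (γ : E →ₐ[K] E).comp σ
  one_smul _ := rfl
  mul_smul _ _ _ := rfl

theorem galois_smul_apply (γ : E ≃ₐ[K] E) (σ : L →ₐ[K] E) (x : L) : (γ • σ) x = γ (σ x) := rfl

theorem stabilizer_embedding (σ : L →ₐ[K] E) :
    MulAction.stabilizer (E ≃ₐ[K] E) σ = σ.fieldRange.fixingSubgroup := by
  ext γ
  rw [MulAction.mem_stabilizer_iff, IntermediateField.mem_fixingSubgroup_iff, DFunLike.ext_iff]
  exact ⟨fun h _ ⟨x, hx⟩ => hx ▸ h x, fun h x => h _ ⟨x, rfl⟩⟩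

theorem isPretransitive_embeddings [Normal K E] :
    MulAction.IsPretransitive (E ≃ₐ[K] E) (L →ₐ[K] E) where
  exists_smul_eq σ τ := by
    let χ : σ.fieldRange ≃ₐ[K] τ.fieldRange :=
      (AlgEquiv.ofInjectiveField σ).symm.trans (AlgEquiv.ofInjectiveField τ)
    refine ⟨χ.liftNormal E, AlgHom.ext fun x => ?_⟩
    have hχ : χ (AlgEquiv.ofInjectiveField σ x) = AlgEquiv.ofInjectiveField τ x :=
      congrArg (AlgEquiv.ofInjectiveField τ) ((AlgEquiv.ofInjectiveField σ).symm_apply_apply x)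
    exact (χ.liftNormal_commutes E _).trans (congrArg Subtype.val hχ)

theorem faithfulSMul_embeddings [Algebra.IsAlgebraic K L] [IsNormalClosure K L E] :
    FaithfulSMul (E ≃ₐ[K] E) (L →ₐ[K] E) := by
  refine faithfulSMul_iff.mpr fun γ hγ => ?_
  have hfix (τ : L →ₐ[K] E) : γ ∈ τ.fieldRange.fixingSubgroup := stabilizer_embedding τ ▸ hγ τ
  have hle : IntermediateField.normalClosure K L E ≤
      IntermediateField.fixedField (Subgroup.zpowers γ) :=
    iSup_le fun τ => (IntermediateField.le_iff_le _ _).mpr (Subgroup.zpowers_le.mpr (hfix τ))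
  have htop := (Algebra.IsAlgebraic.isNormalClosure_iff.mp ‹IsNormalClosure K L E›).2
  rwa [htop, IntermediateField.le_iff_le, Subgroup.zpowers_le, IntermediateField.fixingSubgroup_top,
    Subgroup.mem_bot] at hle

end Embeddings

namespace HopfGaloisStructure

variable {K L H : Type*} [Field K] [Field L] [Algebra K L]
  [Ring H] [HopfAlgebra K H] [Coalgebra.IsCocomm K H] (S : HopfGaloisStructure K L H)
  {E : Type*} [Field E] [Algebra K E]

/-- The map `E ⊗ H → Hom_K(L, E)`, `e ⊗ h ↦ (y ↦ e * σ (h · y))`, by which the scalar extension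
`E ⊗ H` acts on an embedding `σ` from the right. -/
noncomputable def twist (σ : L →ₐ[K] E) : E ⊗[K] H →ₗ[E] L →ₗ[K] E :=
  LinearMap.liftBaseChange E (LinearMap.compRight K σ.toLinearMap ∘ₗ S.act.toLinearMap)

@[simp]
theorem twist_tmul (σ : L →ₐ[K] E) (e : E) (h : H) (y : L) :
    S.twist σ (e ⊗ₜ h) y = e * σ (S.act h y) := by
  simp [twist]

theorem twist_one (σ : L →ₐ[K] E) : S.twist σ 1 = σ.toLinearMap := by
  ext y
  simp [Algebra.TensorProduct.one_def]

theorem twist_mul_tmul (σ : L →ₐ[K] E) (u : E ⊗[K] H) (e : E) (h : H) (y : L) :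
    S.twist σ (u * e ⊗ₜ h) y = e * S.twist σ u (S.act h y) := by
  induction u with
  | zero => simp
  | add a b ha hb => simp only [map_add, LinearMap.add_apply, add_mul, mul_add, ha, hb]
  | tmul f k =>
    rw [Algebra.TensorProduct.tmul_mul_tmul, twist_tmul, twist_tmul, map_mul, Module.End.mul_apply,
      mul_comm f e, mul_assoc]

theorem twist_mul {σ τ : L →ₐ[K] E} {u : E ⊗[K] H} (hu : S.twist σ u = τ.toLinearMap)
    (v : E ⊗[K] H) : S.twist σ (u * v) = S.twist τ v := by
  ext y
  induction v with
  | zero => simp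
  | add a b ha hb => simp only [map_add, LinearMap.add_apply, mul_add, ha, hb]
  | tmul e h => rw [twist_mul_tmul, hu, twist_tmul, AlgHom.toLinearMap_apply]

theorem twist_galois_smul (γ : E ≃ₐ[K] E) (σ : L →ₐ[K] E) (u : E ⊗[K] H) (y : L) :
    S.twist (γ • σ) (Algebra.TensorProduct.map (γ : E →ₐ[K] E) (AlgHom.id K H) u) y =
      γ (S.twist σ u y) := by
  induction u with
  | zero => simp
  | add a b ha hb => simp only [map_add, LinearMap.add_apply, ha, hb]
  | tmul e h => simp [galois_smul_apply]

theorem twist_apply_one (σ : L →ₐ[K] E) (u : E ⊗[K] H) :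
    S.twist σ u 1 = Coalgebra.counit (R := E) u := by
  induction u with
  | zero => simp
  | add a b ha hb => simp only [map_add, LinearMap.add_apply, ha, hb]
  | tmul e h =>
    have h1 := S.act_algebraMap h 1
    rw [map_one, mul_one] at h1
    simp [h1, Algebra.smul_def, mul_comm]

/-- The evaluation `s ⊗ t ↦ twist σ s x * twist σ t y`, through which the comultiplication of
`E ⊗ H` computes `twist σ u (x * y)`. -/
noncomputable def twistTensor (σ : L →ₐ[K] E) (x y : L) : (E ⊗[K] H) ⊗[E] (E ⊗[K] H) →ₗ[E] E :=
  LinearMap.mul' E E ∘ₗ TensorProduct.map ((S.twist σ).flip x) ((S.twist σ).flip y)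

theorem twist_apply_mul (σ : L →ₐ[K] E) (u : E ⊗[K] H) (x y : L) :
    S.twist σ u (x * y) = S.twistTensor σ x y (Coalgebra.comul (R := E) u) := by
  induction u with
  | zero => simp
  | add a b ha hb => simp only [map_add, LinearMap.add_apply, ha, hb]
  | tmul e h =>
    rw [twist_tmul, S.act_mul, TensorProduct.comul_tmul, CommSemiring.comul_apply]
    generalize Coalgebra.comul (R := K) h = t
    induction t with
    | zero => simp
    | add a b ha hb => simp only [map_add, mul_add, TensorProduct.tmul_add, ha, hb]
    | tmul h k =>
      simp only [twistTensor, TensorProduct.map_tmul, LinearMap.flip_apply,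
        AlgHom.toLinearMap_apply, LinearMap.mul'_apply, map_mul, LinearMap.coe_comp,
        TensorProduct.AlgebraTensorModule.tensorTensorTensorComm_tmul, Function.comp_apply,
        twist_tmul, one_mul]
      ring

/-- A group-like element `u` of `E ⊗ H` carries an embedding `σ` to the embedding `twist σ u`. -/
noncomputable def translate (u : GroupLike E (E ⊗[K] H)) (σ : L →ₐ[K] E) : L →ₐ[K] E :=
  .ofLinearMap (S.twist σ u) (by rw [twist_apply_one, u.isGroupLikeElem_val.counit_eq_one])
    fun x y => by rw [twist_apply_mul, u.isGroupLikeElem_val.comul_eq_tmul_self]; rfl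

theorem translate_one (σ : L →ₐ[K] E) : S.translate (1 : GroupLike E (E ⊗[K] H)) σ = σ :=
  AlgHom.toLinearMap_injective (S.twist_one σ)

theorem translate_mul (u v : GroupLike E (E ⊗[K] H)) (σ : L →ₐ[K] E) :
    S.translate (u * v) σ = S.translate v (S.translate u σ) :=
  AlgHom.toLinearMap_injective (S.twist_mul (τ := S.translate u σ) rfl v.val)

variable (E) in
/-- The Greither–Pareigis subgroup of the permutations of the embeddings of `L` into `E`. The
opposite group appears because `E ⊗ H` acts on embeddings from the right. -/
noncomputable def permSubgroup : Subgroup (Equiv.Perm (L →ₐ[K] E)) :=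
  (MonoidHom.toHomPerm (G := (GroupLike E (E ⊗[K] H))ᵐᵒᵖ)
    { toFun u := (S.translate u.unop : Function.End (L →ₐ[K] E))
      map_one' := funext S.translate_one
      map_mul' u v := funext (S.translate_mul v.unop u.unop) }).range

theorem mem_permSubgroup {f : Equiv.Perm (L →ₐ[K] E)} :
    f ∈ S.permSubgroup E ↔ ∃ u, S.translate u = f := by
  constructor
  · rintro ⟨u, rfl⟩
    exact ⟨u.unop, rfl⟩
  · rintro ⟨u, hu⟩
    exact ⟨.op u, Equiv.ext (congrFun hu)⟩

theorem twist_rTensor (σ : L →ₐ[K] E) (t : L ⊗[K] H) (y : L) :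
    S.twist σ (σ.toLinearMap.rTensor H t) y = σ (hopfGaloisMap S.act t y) := by
  induction t with
  | zero => simp
  | add a b ha hb => simp only [map_add, LinearMap.add_apply, ha, hb]
  | tmul e h => simp [hopfGaloisMap_tmul]

section FiniteDimensional

variable [FiniteDimensional K L]

include S in
theorem finiteDimensional : FiniteDimensional K H := by
  have : FiniteDimensional K (L ⊗[K] H) :=
    Module.Finite.of_injective (hopfGaloisMap S.act) S.bijective.1
  exact Module.Finite.of_injective
    (Algebra.TensorProduct.includeRight : H →ₐ[K] L ⊗[K] H).toLinearMap
    (Algebra.TensorProduct.includeRight_injective (algebraMap K L).injective)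

include S in
theorem finrank_eq : Module.finrank K H = Module.finrank K L := by
  have h := (LinearEquiv.ofBijective _ S.bijective).finrank_eq
  rw [Module.finrank_tensorProduct, Module.finrank_linearMap] at h
  exact Nat.eq_of_mul_eq_mul_left Module.finrank_pos h

theorem twist_surjective (σ : L →ₐ[K] E) : Function.Surjective (S.twist σ) := by
  intro f
  let b := Module.finBasis K L
  choose t ht using fun i => S.bijective.2 (Algebra.linearMap K L ∘ₗ b.coord i)
  refine ⟨∑ i, f (b i) • σ.toLinearMap.rTensor H (t i), b.ext fun j => ?_⟩
  simp [twist_rTensor, ht, Finsupp.single_apply]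

theorem twist_bijective (σ : L →ₐ[K] E) : Function.Bijective (S.twist σ) := by
  have := S.finiteDimensional
  have hrank : Module.finrank E (E ⊗[K] H) = Module.finrank E (L →ₗ[K] E) := by
    rw [Module.finrank_baseChange, Module.finrank_linearMap, Module.finrank_self, mul_one,
      S.finrank_eq]
  exact ⟨(LinearMap.injective_iff_surjective_of_finrank_eq_finrank hrank).mpr
    (S.twist_surjective σ), S.twist_surjective σ⟩

theorem ext_twistTensor (σ : L →ₐ[K] E) {s t : (E ⊗[K] H) ⊗[E] (E ⊗[K] H)}
    (h : ∀ x y, S.twistTensor σ x y s = S.twistTensor σ x y t) : s = t := by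
  let b := Module.finBasis K L
  let w : Module.Basis _ E (E ⊗[K] H) := .ofEquivFun
    ((LinearEquiv.ofBijective _ (S.twist_bijective σ)).trans (b.constr E).symm)
  have hw (u i) : w.repr u i = S.twist σ u (b i) := rfl
  have hww (i j) : (w.tensorProduct w).coord (i, j) = S.twistTensor σ (b i) (b j) :=
    TensorProduct.ext' fun u v => by simp [twistTensor, hw, mul_comm]
  refine (w.tensorProduct w).ext_elem fun (i, j) => ?_
  simpa only [← hww, Module.Basis.coord_apply] using h (b i) (b j)

theorem isGroupLikeElem_of_twist_eq {σ τ : L →ₐ[K] E} {u : E ⊗[K] H}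
    (h : S.twist σ u = τ.toLinearMap) : IsGroupLikeElem E u := by
  refine ⟨?_, S.ext_twistTensor σ fun x y => ?_⟩
  · rw [← S.twist_apply_one σ, h, AlgHom.toLinearMap_apply, map_one]
  · rw [← twist_apply_mul, h, AlgHom.toLinearMap_apply, map_mul]
    simp [twistTensor, h]

theorem isPretransitive_permSubgroup :
    MulAction.IsPretransitive (S.permSubgroup E) (L →ₐ[K] E) where
  exists_smul_eq σ τ := by
    obtain ⟨u, hu⟩ := S.twist_surjective σ τ.toLinearMap
    let g : GroupLike E (E ⊗[K] H) := ⟨u, S.isGroupLikeElem_of_twist_eq hu⟩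
    exact ⟨⟨_, .op g, rfl⟩, AlgHom.toLinearMap_injective hu⟩

theorem isCancelSMul_permSubgroup : IsCancelSMul (S.permSubgroup E) (L →ₐ[K] E) := by
  refine isCancelSMul_iff_eq_one_of_smul_eq.mpr ?_
  rintro ⟨f, hf⟩ σ hσ
  obtain ⟨u, hu⟩ := S.mem_permSubgroup.mp hf
  have hfix : S.twist σ u.val = σ.toLinearMap :=
    congrArg AlgHom.toLinearMap ((congrFun hu σ).trans hσ)
  have hone : u = 1 :=
    GroupLike.val_injective ((S.twist_bijective σ).1 (hfix.trans (S.twist_one σ).symm))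
  subst hone
  exact Subtype.ext (Equiv.ext fun τ => (congrFun hu τ).symm.trans (S.translate_one τ))

theorem exists_translate_galois_smul [Nonempty (L →ₐ[K] E)] (γ : E ≃ₐ[K] E)
    (u : GroupLike E (E ⊗[K] H)) :
    ∃ v, ∀ σ : L →ₐ[K] E, S.translate v (γ • σ) = γ • S.translate u σ := by
  let v := Algebra.TensorProduct.map (γ : E →ₐ[K] E) (AlgHom.id K H) u.val
  have hv (σ : L →ₐ[K] E) : S.twist (γ • σ) v = (γ • S.translate u σ).toLinearMap :=
    LinearMap.ext (S.twist_galois_smul γ σ u.val)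
  have hgl : IsGroupLikeElem E v := S.isGroupLikeElem_of_twist_eq (hv (Classical.arbitrary _))
  exact ⟨⟨v, hgl⟩, fun σ => AlgHom.toLinearMap_injective (hv σ)⟩

theorem toPerm_mem_normalizer_permSubgroup [Nonempty (L →ₐ[K] E)] (γ : E ≃ₐ[K] E) :
    MulAction.toPerm γ ∈ Subgroup.normalizer (S.permSubgroup E : Set (Equiv.Perm (L →ₐ[K] E))) := by
  refine Subgroup.mem_normalizer_fintype fun f hf => ?_
  obtain ⟨u, hu⟩ := S.mem_permSubgroup.mp hf
  obtain ⟨v, hv⟩ := S.exists_translate_galois_smul γ u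
  refine S.mem_permSubgroup.mpr ⟨v, funext fun σ => ?_⟩
  calc S.translate v σ = S.translate v (γ • γ⁻¹ • σ) := by rw [smul_inv_smul]
    _ = γ • f (γ⁻¹ • σ) := by rw [hv, hu]

include S in
theorem derivedSeries_galois_eq_bot [IsNormalClosure K L E]
    (hcard : Squarefree (Nat.card (L →ₐ[K] E))) : derivedSeries (E ≃ₐ[K] E) 4 = ⊥ := by
  have : Nonempty (L →ₐ[K] E) := (Nat.card_ne_zero.mp hcard.ne_zero).1
  have := faithfulSMul_embeddings (K := K) (L := L) (E := E)
  have := S.isPretransitive_permSubgroup (E := E)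
  have := S.isCancelSMul_permSubgroup (E := E)
  let f := (MulAction.toPermHom (E ≃ₐ[K] E) (L →ₐ[K] E)).codRestrict
    (Subgroup.normalizer (S.permSubgroup E : Set (Equiv.Perm (L →ₐ[K] E))))
    S.toPerm_mem_normalizer_permSubgroup
  have hf : Function.Injective f := fun _ _ h => MulAction.toPerm_injective (congrArg Subtype.val h)
  exact derivedSeries_eq_bot_of_injective hf
    (derivedSeries_normalizer_eq_bot hcard (S.permSubgroup E))

end FiniteDimensional

end HopfGaloisStructure

theorem card_eq_card_embeddings {G X K L E : Type*} [Group G] [MulAction G X]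
    [MulAction.IsPretransitive G X] [Field K] [Field L] [Field E] [Algebra K L] [Algebra K E]
    [Algebra L E] [IsScalarTower K L E] [Normal K E] (hG : RealisesPermGroup K L E G X) :
    Nat.card X = Nat.card (L →ₐ[K] E) := by
  obtain ⟨x, θ, hθ⟩ := hG
  have := isPretransitive_embeddings (K := K) (L := L) (E := E)
  calc Nat.card X = (MulAction.stabilizer G x).index :=
        (MulAction.index_stabilizer_of_transitive G x).symm
    _ = ((MulAction.stabilizer G x).map θ.toMonoidHom).index :=
        (Subgroup.index_map_equiv _ θ).symm
    _ = (MulAction.stabilizer (E ≃ₐ[K] E) (IsScalarTower.toAlgHom K L E)).index := by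
        rw [hθ, stabilizer_embedding]
    _ = Nat.card (L →ₐ[K] E) := MulAction.index_stabilizer_of_transitive _ _

theorem theorem3p3_general {G X K L E H : Type*}
    [Group G] [MulAction G X] [MulAction.IsPretransitive G X] (hn : Squarefree (Nat.card X))
    [Field K] [Field L] [Field E] [Algebra K L] [Algebra K E] [Algebra L E] [IsScalarTower K L E]
    [FiniteDimensional K L] [IsNormalClosure K L E] (hG : RealisesPermGroup K L E G X)
    [Ring H] [HopfAlgebra K H] [Coalgebra.IsCocomm K H] (S : HopfGaloisStructure K L H) :
    derivedSeries G 4 = ⊥ ∧ Group.IsSolvable G := by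
  have := IsNormalClosure.normal (F := K) (K := L) (L := E)
  have hcard : Squarefree (Nat.card (L →ₐ[K] E)) := card_eq_card_embeddings hG ▸ hn
  obtain ⟨-, θ, -⟩ := hG
  have h : derivedSeries G 4 = ⊥ :=
    derivedSeries_eq_bot_of_injective (f := θ.toMonoidHom) θ.injective
      (S.derivedSeries_galois_eq_bot hcard)
  exact ⟨h, ⟨4, h⟩⟩

theorem theorem3p3 {G X K L E H : Type*}
    -- a transitive permutation group `G` on the finite set `X`, of squarefree degree
    [Group G] [Finite X] [MulAction G X] [FaithfulSMul G X] [MulAction.IsPretransitive G X]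
    (hn : Squarefree (Nat.card X))
    -- a finite separable extension `L/K` with normal closure `E/K`
    [Field K] [Field L] [Field E] [Algebra K L] [Algebra K E] [Algebra L E] [IsScalarTower K L E]
    [FiniteDimensional K L] [Algebra.IsSeparable K L] [IsNormalClosure K L E]
    (hG : RealisesPermGroup K L E G X)
    -- a Hopf-Galois structure on `L/K`
    [Ring H] [HopfAlgebra K H] [Coalgebra.IsCocomm K H] (S : HopfGaloisStructure K L H) :
    derivedSeries G 4 = ⊥ ∧ Group.IsSolvable G :=
  theorem3p3_general hn hG S
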